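/- For $n\in\mathbb N=\{0,1,2,\dots\}$ and a vector of nineteen unknowns $\vec u=(k,v,a,b,c,d,e,f,g,h,i,j,q,l,m,p,x,y,z)\in\mathbb N^{19}$ let $$\begin{aligned}R(n,\vec u)={}&(a-2^k)^2+(f-2^{2k})^2+(g-11^{f+2a})^2+(h-11^{f+a})^2+(i-11^a)^2+(j-11^{2a})^2\\&+(q-11^{2a}b)^2+(l-11^ab)^2+(m-11^ae)^2+(p-2^{k+2}z)^2\\&+(2^{g+4l}-2^{2h+q+b+c})^2+(2^j-2^{4i+c+d})^2+(2^b-2^{m+x})^2\\&+(2^i-2^{x+y+1})^2+(2^p-2^{x+z})^2+(2^n-2^{k+v})^2 .\end{aligned}$$ Let $t(n)=11^{2^{2n+1}}$ and $w(n)=36\,t(n)+6$. Let $HW(N)$ be the number of ones in the binary representation of $N$, and for $t,w\in\mathbb N$ let $$M(R,n,t,w)=\sum_{\vec u\in\{0,\dots,t-1\}^{19}}2^{2w\beta(\vec u)}(2^w-1)\bigl(2^w-R(n,\vec u)+1\bigr),\qquad \beta(\vec u)=\sum_{s=1}^{19}u_s\,t^{s-1}.$$ An arithmetic term in $n$ is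 an expression built from natural-number constants and the variable $n$ by finitely many applications of $r+s$, $\max(r-s,0)$, $r\cdot s$, $\lfloor r/s\rfloor$ and $2^r$, in whose evaluation no division by $0$ occurs, whatever the value of $n\in\mathbb N$. Theorem. 1. $R$ is single-fold: for all $n,k\in\mathbb N$ the equation $R(n,\vec u)=0$ has a solution $\vec u\in\mathbb N^{19}$ with first coordinate $k$ if and only if $1\le k\le n$ and $2^{k+2}-1$ is prime, and it has at most one such solution. 2. For every $n\in\mathbb N$ with $n\neq1$, the number of $k\in\{0,\dots,n\}$ such that $2^{k+2}-1$ is prime equals $$\frac{HW\bigl(M(R,n,t(n),w(n))\bigr)}{w(n)}-t(n)^{19}+1 .$$ 3. The expression displayed in 2 is equal, for all $n\in\mathbb N$, to an arithmetic term in $n$. Likewise the counting function $n\mapsto\#\{k\in\{0,\dots,n\}: 2^{k+2}-1\text{ is prime}\}$ is equal, for all $n\in\mathbb N$ (including $n=1$), to an arithmetic term in $n$. -/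

import Mathlib

/-- Arithmetic terms in the variables `n₀, …, n_{m-1}`: expressions built from natural-number
constants and the variables by `+`, modified subtraction, `*`, floor division and `2 ^ _`. -/
inductive ArithTerm (m : ℕ) : Type
  | const (c : ℕ) : ArithTerm m
  | var (i : Fin m) : ArithTerm m
  | add (s t : ArithTerm m) : ArithTerm m
  | monus (s t : ArithTerm m) : ArithTerm m
  | mul (s t : ArithTerm m) : ArithTerm m
  | floorDiv (s t : ArithTerm m) : ArithTerm m
  | twoPow (s : ArithTerm m) : ArithTerm m

/-- The value of an arithmetic term at the assignment `r` of its variables. -/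
def ArithTerm.eval {m : ℕ} (r : Fin m → ℕ) : ArithTerm m → ℕ
  | .const c => c
  | .var i => r i
  | .add s t => s.eval r + t.eval r
  | .monus s t => s.eval r - t.eval r
  | .mul s t => s.eval r * t.eval r
  | .floorDiv s t => s.eval r / t.eval r
  | .twoPow s => 2 ^ s.eval r

/-- No division by zero occurs when the term is evaluated at `r`, so that its value does not
depend on a convention for division by zero. -/
def ArithTerm.IsDefinedAt {m : ℕ} (r : Fin m → ℕ) : ArithTerm m → Prop
  | .const _ => True
  | .var _ => True
  | .add s t => s.IsDefinedAt r ∧ t.IsDefinedAt r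
  | .monus s t => s.IsDefinedAt r ∧ t.IsDefinedAt r
  | .mul s t => s.IsDefinedAt r ∧ t.IsDefinedAt r
  | .floorDiv s t => s.IsDefinedAt r ∧ t.IsDefinedAt r ∧ t.eval r ≠ 0
  | .twoPow s => s.IsDefinedAt r

/-- The number of ones in the binary representation of `n`. -/
def hammingWeight (n : ℕ) : ℕ := (Nat.digits 2 n).count 1

/-- `δ(a, b) = (2^b - 1) (2^b - a + 1)`. -/
def mazzantiDelta (a : ℤ) (b : ℕ) : ℤ := (2 ^ b - 1) * (2 ^ b - a + 1)

/-- `β(a₁, …, a_k) = a₁ + a₂ t + ⋯ + a_k t^(k-1)`. -/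
def mazzantiBeta {k t : ℕ} (a : Fin k → Fin t) : ℕ := ∑ i, (a i : ℕ) * t ^ (i : ℕ)

/-- `M(f, t, w) = ∑ 2^(2 w β(a)) δ(f(a), w)`, the sum over all `a ∈ {0, …, t-1}^k`. -/
def mazzantiM {k : ℕ} (f : (Fin k → ℕ) → ℤ) (t w : ℕ) : ℤ :=
  ∑ a : Fin k → Fin t, 2 ^ (2 * w * mazzantiBeta a) * mazzantiDelta (f fun i => (a i : ℕ)) w

/-- The sum of squares `R` with parameter `n`, in nineteen unknowns written out one by one. -/
def mersenneSumOfSquares (n k v a b c d e f g h i j q l m p x y z : ℕ) : ℤ :=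
  ((a : ℤ) - 2 ^ k) ^ 2
  + ((f : ℤ) - 2 ^ (2 * k)) ^ 2
  + ((g : ℤ) - 11 ^ (f + 2 * a)) ^ 2
  + ((h : ℤ) - 11 ^ (f + a)) ^ 2
  + ((i : ℤ) - 11 ^ a) ^ 2
  + ((j : ℤ) - 11 ^ (2 * a)) ^ 2
  + ((q : ℤ) - 11 ^ (2 * a) * b) ^ 2
  + ((l : ℤ) - 11 ^ a * b) ^ 2
  + ((m : ℤ) - 11 ^ a * e) ^ 2
  + ((p : ℤ) - 2 ^ (k + 2) * z) ^ 2
  + ((2 : ℤ) ^ (g + 4 * l) - 2 ^ (2 * h + q + b + c)) ^ 2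
  + ((2 : ℤ) ^ j - 2 ^ (4 * i + c + d)) ^ 2
  + ((2 : ℤ) ^ b - 2 ^ (m + x)) ^ 2
  + ((2 : ℤ) ^ i - 2 ^ (x + y + 1)) ^ 2
  + ((2 : ℤ) ^ p - 2 ^ (x + z)) ^ 2
  + ((2 : ℤ) ^ n - 2 ^ (k + v)) ^ 2

/-- `R(n, u)`, with the unknowns collected in the vector
`u = (k, v, a, b, c, d, e, f, g, h, i, j, q, l, m, p, x, y, z)`. -/
def mersenneR (n : ℕ) (u : Fin 19 → ℕ) : ℤ :=
  mersenneSumOfSquares n (u 0) (u 1) (u 2) (u 3) (u 4) (u 5) (u 6) (u 7) (u 8) (u 9)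
    (u 10) (u 11) (u 12) (u 13) (u 14) (u 15) (u 16) (u 17) (u 18)

/-- `t(n) = 11^(2^(2n+1))`. -/
def mersenneT (n : ℕ) : ℕ := 11 ^ 2 ^ (2 * n + 1)

/-- `w(n) = 36 t(n) + 6`. -/
def mersenneW (n : ℕ) : ℕ := 36 * mersenneT n + 6

/-- The number of `k ∈ {0, …, n}` such that `2^(k+2) - 1` is prime. -/
def mersenneCount (n : ℕ) : ℕ :=
  ((Finset.range (n + 1)).filter fun k => Nat.Prime (2 ^ (k + 2) - 1)).card

/-- The rational number `HW(M(R, n, t(n), w(n))) / w(n) - t(n)^19 + 1`. -/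
def mersenneFormula (n : ℕ) : ℚ :=
  (hammingWeight (mazzantiM (mersenneR n) (mersenneT n) (mersenneW n)).toNat : ℚ) / mersenneW n
    - (mersenneT n : ℚ) ^ 19 + 1

/-!
**The single-fold definition.** Put `X = 11^a` with `a = 2^k`. The equations of `R` force
`X^(a+2) - 2X^(a+1) = (X² - 4X + 1) b + c` with `0 ≤ c ≤ X² - 4X`, so `b` is the quotient of a
division with remainder. Since `(X² - 2X) / (X² - 4X + 1)` is the generating function, in `1 / X`,
of `U_i = ((2 + √3)^i + (2 - √3)^i) / 2`, the quotient is `∑ i ≤ a, U_i X^(a-i)`, whose last digit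
`x` in base `X` is `U_a` (`exists_pellTwo_division`). Now `2 U_(2^k)` is the `k`-th term of the
Lucas–Lehmer sequence, so `2^(k+2) - 1` divides `x` exactly if it is a prime other than `3`
(`one_le_and_prime_iff_dvd_pellTwo`). All unknowns are determined by `k` (`mersenneR_unique`).

**The counting formula.** If `0 ≤ R ≤ 2^w` on a box, the binary digits of `M` fall into blocks of
length `2w`, one for each point of the box, with `2w` ones at a zero of `R` and `w` ones elsewhere
(`hammingWeight_mazzantiM`). The numbers `t(n)` and `w(n)` are large enough for the box to contain
all zeros of `R`, except for `n = 1`, where it contains none. The prime `3`, for `k = 0`, accounts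
for the final `+ 1`.

**Arithmetic terms.** Powers are remainders of powers of `2` (`pow_eq_two_pow_mod`). Central
binomial coefficients and greatest common divisors are digits, in a large base, of expressions
that enumerate the objects they count (`sum_pow_div_mod_eq_card`). By Kummer's theorem the digit sum
of `N` is the exponent of `2` in `N.centralBinom`, which is read off from
`gcd(m, 2^m) = 2^(padicValNat 2 m)`. Finally `R` is an exponential polynomial whose exponents are
linear in the unknowns, so the sum `M` over the box is a combination of products of
one-dimensional sums `∑ j < t, j^r q^j`, each of which has a closed form
(`IsExpPoly.sum_box`). For `n = 1` the formula and the count differ by `1`, and a correction term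
makes up for this.
-/

/-! ### Binary digit sums -/

theorem hammingWeight_zero : hammingWeight 0 = 0 := by simp [hammingWeight]

theorem hammingWeight_two_mul (n : ℕ) : hammingWeight (2 * n) = hammingWeight n := by
  rcases Nat.eq_zero_or_pos n with rfl | h
  · rfl
  · have := Nat.digits_add 2 (by norm_num) 0 n (by norm_num) (Or.inr h.ne')
    rw [zero_add] at this
    rw [hammingWeight, this]
    simp [hammingWeight]

theorem hammingWeight_two_mul_add_one (n : ℕ) :
    hammingWeight (2 * n + 1) = hammingWeight n + 1 := by
  have := Nat.digits_add 2 (by norm_num) 1 n (by norm_num) (Or.inl one_ne_zero)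
  rw [add_comm (2 * n), hammingWeight, this]
  simp [hammingWeight]

theorem hammingWeight_eq_sum_digits (n : ℕ) : hammingWeight n = (Nat.digits 2 n).sum := by
  have h : ∀ l : List ℕ, (∀ d ∈ l, d < 2) → l.count 1 = l.sum := by
    intro l
    induction l with
    | nil => simp
    | cons d l ih =>
      intro hl
      have hd : d < 2 := hl d (by simp)
      have := ih fun e he => hl e (by simp [he])
      interval_cases d <;> simp [this, add_comm]
  exact h _ fun d hd => Nat.digits_lt_base (by norm_num) hd

theorem hammingWeight_add_two_pow_mul {x s : ℕ} (y : ℕ) (hx : x < 2 ^ s) :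
    hammingWeight (x + 2 ^ s * y) = hammingWeight x + hammingWeight y := by
  induction s generalizing x with
  | zero =>
    obtain rfl : x = 0 := by simpa using hx
    simp [hammingWeight_zero]
  | succ s ih =>
    rw [pow_succ] at hx ⊢
    obtain ⟨z, rfl | rfl⟩ := Nat.even_or_odd' x
    · rw [show 2 * z + 2 ^ s * 2 * y = 2 * (z + 2 ^ s * y) by ring, hammingWeight_two_mul,
        hammingWeight_two_mul, ih (by lia)]
    · rw [show 2 * z + 1 + 2 ^ s * 2 * y = 2 * (z + 2 ^ s * y) + 1 by ring,
        hammingWeight_two_mul_add_one, hammingWeight_two_mul_add_one, ih (by lia)]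
      ring

/-- Subtracting `c` from `11…1` flips every binary digit of `c`. -/
theorem hammingWeight_add_of_add_eq {w c c' : ℕ} (h : c + c' + 1 = 2 ^ w) :
    hammingWeight c + hammingWeight c' = w := by
  induction w generalizing c c' with
  | zero =>
    obtain ⟨rfl, rfl⟩ : c = 0 ∧ c' = 0 := by simpa using h
    rfl
  | succ w ih =>
    rw [pow_succ] at h
    obtain ⟨z, rfl | rfl⟩ := Nat.even_or_odd' c <;> obtain ⟨z', rfl | rfl⟩ := Nat.even_or_odd' c'
    · lia
    · rw [hammingWeight_two_mul, hammingWeight_two_mul_add_one, ← ih (c := z) (c' := z') (by lia)]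
      ring
    · rw [hammingWeight_two_mul, hammingWeight_two_mul_add_one, ← ih (c := z) (c' := z') (by lia)]
      ring
    · lia

theorem hammingWeight_two_pow_sub_one_mul {w m : ℕ} (hm : 1 ≤ m) (hm' : m ≤ 2 ^ w) :
    hammingWeight ((2 ^ w - 1) * m) = w := by
  obtain ⟨c, rfl⟩ := Nat.exists_eq_add_of_le' hm
  obtain ⟨c', hc'⟩ := Nat.exists_eq_add_of_le hm'
  have h : (2 ^ w - 1) * (c + 1) = c' + 2 ^ w * c := by
    rw [hc', show c + 1 + c' - 1 = c + c' by lia]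
    ring
  rw [h, hammingWeight_add_two_pow_mul c (by lia), add_comm]
  exact hammingWeight_add_of_add_eq (by lia)

theorem hammingWeight_two_pow_sub_one (w : ℕ) : hammingWeight (2 ^ w - 1) = w := by
  simpa using hammingWeight_two_pow_sub_one_mul (w := w) le_rfl Nat.one_le_two_pow

theorem sum_pow_mul_lt {B N : ℕ} {d : ℕ → ℕ} (hd : ∀ j < N, d j < B) :
    ∑ j ∈ Finset.range N, B ^ j * d j < B ^ N := by
  induction N with
  | zero => simp
  | succ N ih =>
    rw [Finset.sum_range_succ, pow_succ]
    have h1 := ih fun j hj => hd j (by lia)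
    have h2 : B ^ N * (d N + 1) ≤ B ^ N * B := Nat.mul_le_mul_left _ (hd N (by lia))
    lia

theorem hammingWeight_sum_blocks {s N : ℕ} {d : ℕ → ℕ} (hd : ∀ j < N, d j < 2 ^ s) :
    hammingWeight (∑ j ∈ Finset.range N, (2 ^ s) ^ j * d j)
      = ∑ j ∈ Finset.range N, hammingWeight (d j) := by
  induction N with
  | zero => simp [hammingWeight_zero]
  | succ N ih =>
    have hd' : ∀ j < N, d j < 2 ^ s := fun j hj => hd j (by lia)
    have h := sum_pow_mul_lt hd'
    rw [← pow_mul] at h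
    rw [Finset.sum_range_succ, Finset.sum_range_succ, ← ih hd', ← pow_mul 2 s N,
      hammingWeight_add_two_pow_mul _ h]

/-! ### Counting zeros by a digit sum -/

theorem mazzantiDelta_eq_natCast {a : ℤ} {w : ℕ} (ha : 0 ≤ a) (ha' : a ≤ 2 ^ w) :
    ∃ d : ℕ, mazzantiDelta a w = d ∧ d < 2 ^ (2 * w) ∧
      hammingWeight d = w + if a = 0 then w else 0 := by
  lift a to ℕ using ha
  norm_cast at ha'
  obtain ⟨m, hm⟩ := Nat.exists_eq_add_of_le ha'
  have hw : 1 ≤ 2 ^ w := Nat.one_le_two_pow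
  have hsq : 2 ^ (2 * w) = 2 ^ w * 2 ^ w := by rw [two_mul, pow_add]
  refine ⟨(2 ^ w - 1) * (m + 1), ?_, ?_, ?_⟩
  · rw [mazzantiDelta]
    have h : (2 : ℤ) ^ w = a + m := by exact_mod_cast hm
    push_cast [Nat.cast_sub hw]
    rw [h]
    ring
  · have h1 : (2 ^ w - 1) * (m + 1) ≤ (2 ^ w - 1) * (2 ^ w + 1) := Nat.mul_le_mul_left _ (by lia)
    obtain ⟨r, hr⟩ := Nat.exists_eq_add_of_le' hw
    rw [hr, Nat.add_sub_cancel] at h1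
    rw [hsq, hr, Nat.add_sub_cancel]
    nlinarith
  · by_cases h0 : a = 0
    · have : (2 ^ w - 1) * (m + 1) = 2 ^ (2 * w) - 1 := by
        obtain ⟨r, hr⟩ := Nat.exists_eq_add_of_le' hw
        rw [hsq, hr, Nat.add_sub_cancel, show m = r + 1 by lia]
        exact Nat.eq_sub_of_add_eq (by ring)
      rw [this, hammingWeight_two_pow_sub_one]
      simp [h0]
      ring
    · rw [hammingWeight_two_pow_sub_one_mul (by lia) (by lia)]
      simp [h0]

/-- If `0 ≤ f ≤ 2^w` on the box `{0, …, t-1}^k`, then every block of `2w` binary digits of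
`M(f, t, w)` contains `2w` or `w` ones according as `f` vanishes at the corresponding point. -/
theorem hammingWeight_mazzantiM {k t w : ℕ} {f : (Fin k → ℕ) → ℤ}
    (h0 : ∀ a : Fin k → Fin t, 0 ≤ f fun i => (a i : ℕ))
    (hw : ∀ a : Fin k → Fin t, f (fun i => (a i : ℕ)) ≤ 2 ^ w) :
    hammingWeight (mazzantiM f t w).toNat
      = w * (t ^ k + (Finset.univ.filter
          fun a : Fin k → Fin t => f (fun i => (a i : ℕ)) = 0).card) := by
  choose d hd hlt hhw using fun a => mazzantiDelta_eq_natCast (h0 a) (hw a)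
  let e : (Fin k → Fin t) ≃ Fin (t ^ k) := finFunctionFinEquiv
  have he : ∀ a, mazzantiBeta a = (e a : ℕ) := fun a => (finFunctionFinEquiv_apply a).symm
  let D : ℕ → ℕ := fun j => if h : j < t ^ k then d (e.symm ⟨j, h⟩) else 0
  have hD : ∀ a, D (e a) = d a := fun a => by simp [D]
  have hM : mazzantiM f t w
      = ((∑ j ∈ Finset.range (t ^ k), (2 ^ (2 * w)) ^ j * D j : ℕ) : ℤ) := by
    rw [← Fin.sum_univ_eq_sum_range (fun j => (2 ^ (2 * w)) ^ j * D j), ← Equiv.sum_comp e,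
      mazzantiM]
    push_cast
    refine Finset.sum_congr rfl fun a _ => ?_
    rw [hd a, he a, hD a, ← pow_mul]
  rw [hM, Int.toNat_natCast, hammingWeight_sum_blocks]
  · rw [← Fin.sum_univ_eq_sum_range (fun j => hammingWeight (D j)), ← Equiv.sum_comp e]
    simp only [hD, hhw, Finset.sum_add_distrib, ← Finset.sum_filter, Finset.sum_const,
      Finset.card_univ, Fintype.card_fun, Fintype.card_fin, smul_eq_mul]
    ring
  · intro j hj
    simp [D, hj, hlt]

/-! ### The Lucas–Lehmer test through Pell numbers -/

/-- `pellTwo n = ((2 + √3)^n + (2 - √3)^n) / 2`, the `x`-part of the `n`-th solution of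
`x² - 3y² = 1`. -/
abbrev pellTwo (n : ℕ) : ℕ := Pell.xn (a := 2) one_lt_two n

theorem pellTwo_zero : pellTwo 0 = 1 := Pell.xn_zero _

theorem pellTwo_one : pellTwo 1 = 2 := Pell.xn_one _

theorem pellTwo_add_two (n : ℕ) : pellTwo (n + 2) + pellTwo n = 4 * pellTwo (n + 1) :=
  Pell.xn_succ_succ _ n

theorem pellTwo_two_mul (n : ℕ) : pellTwo (2 * n) + 1 = 2 * pellTwo n ^ 2 := by
  have h := Pell.pell_eqz (a := 2) one_lt_two n
  have h' := Pell.xn_add (a := 2) one_lt_two n n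
  rw [← two_mul] at h'
  zify at h' ⊢
  simp only [pellTwo, Pell.xz, Pell.yz] at *
  linear_combination h' - h

theorem pellTwo_pos (n : ℕ) : 1 ≤ pellTwo n := Pell.x_pos _ n

theorem pellTwo_le_succ (n : ℕ) : pellTwo n ≤ pellTwo (n + 1) :=
  ((Pell.strictMono_x (a := 2) one_lt_two) (Nat.lt_succ_self n)).le

theorem lucasLehmer_s_eq (i : ℕ) : LucasLehmer.s i = 2 * (pellTwo (2 ^ i) : ℤ) := by
  induction i with
  | zero => simp [LucasLehmer.s, pellTwo_one]
  | succ i ih =>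
    have h := pellTwo_two_mul (2 ^ i)
    rw [← pow_succ'] at h
    zify at h
    rw [LucasLehmer.s, ih]
    linear_combination -2 * h

/-- The Lucas–Lehmer test. The exponent `2` is excluded on both sides: `3 = 2^2 - 1` is a prime,
but it does not divide `2`. -/
theorem one_le_and_prime_iff_dvd_pellTwo (k : ℕ) :
    (1 ≤ k ∧ Nat.Prime (2 ^ (k + 2) - 1)) ↔ 2 ^ (k + 2) - 1 ∣ pellTwo (2 ^ k) := by
  have hcop : Nat.Coprime (2 ^ (k + 2) - 1) 2 := by
    rw [Nat.coprime_two_right]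
    exact mersenne_odd.2 (by lia)
  have htest : LucasLehmer.LucasLehmerTest (k + 2) ↔ 2 ^ (k + 2) - 1 ∣ pellTwo (2 ^ k) := by
    rw [LucasLehmer.LucasLehmerTest, LucasLehmer.lucasLehmerResidue, Nat.add_sub_cancel,
      LucasLehmer.sZMod_eq_s, lucasLehmer_s_eq]
    have : ((2 * (pellTwo (2 ^ k) : ℤ) : ℤ) : ZMod (2 ^ (k + 2) - 1))
        = ((2 * pellTwo (2 ^ k) : ℕ) : ZMod (2 ^ (k + 2) - 1)) := by push_cast; rfl
    rw [this, ZMod.natCast_eq_zero_iff, hcop.dvd_mul_left]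
  rw [← htest]
  constructor
  · rintro ⟨hk, hp⟩
    exact lucas_lehmer_necessity (k + 2) (by lia) hp
  · intro h
    refine ⟨?_, lucas_lehmer_sufficiency (k + 2) (by lia) h⟩
    rw [htest] at h
    by_contra hk
    obtain rfl : k = 0 := by lia
    norm_num [pellTwo_one] at h

/-! ### Extracting a Pell number by one floor division -/

theorem pellTwo_succ_add_four_le {a : ℕ} (ha : 1 ≤ a) : pellTwo (a + 1) + 4 ≤ 11 ^ a := by
  induction a, ha using Nat.le_induction with
  | base =>
    have := pellTwo_add_two 0
    rw [zero_add, zero_add, pellTwo_zero, pellTwo_one] at this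
    lia
  | succ a ha ih =>
    have := pellTwo_add_two a
    rw [pow_succ]
    lia

/-- `∑ i ≤ a, pellTwo i * X^(a - i)`, evaluated by Horner's rule. -/
def pellHorner (X : ℕ) : ℕ → ℕ
  | 0 => 1
  | a + 1 => X * pellHorner X a + pellTwo (a + 1)

/-- The generating function `∑ pellTwo i / X^i = (X² - 2X) / (X² - 4X + 1)`, truncated after
`i = a` and cleared of denominators. -/
theorem pellHorner_mul_eq (X a : ℕ) :
    ((X : ℤ) ^ 2 - 4 * X + 1) * pellHorner X a
      = X ^ (a + 2) - 2 * X ^ (a + 1) - X * pellTwo (a + 1) + pellTwo a := by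
  induction a with
  | zero =>
    simp [pellHorner]
    ring
  | succ a ih =>
    have h := pellTwo_add_two a
    zify at h
    simp only [pellHorner]
    push_cast
    linear_combination (X : ℤ) * ih + (X : ℤ) * h

/-- The equations between `b, c, d, e, x, y` and `X = 11^a` have a solution with
`x = pellTwo a`. -/
theorem exists_pellTwo_division {a : ℕ} (ha : 1 ≤ a) : ∃ b c d e y : ℕ,
    (11 ^ a) ^ (a + 2) + 4 * (11 ^ a * b)
      = 2 * (11 ^ a) ^ (a + 1) + (11 ^ a) ^ 2 * b + b + c ∧
    (11 ^ a) ^ 2 = 4 * 11 ^ a + c + d ∧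
    b = 11 ^ a * e + pellTwo a ∧ 11 ^ a = pellTwo a + y + 1 := by
  have hU := pellTwo_succ_add_four_le ha
  have hle := pellTwo_le_succ a
  have hpos := pellTwo_pos a
  obtain ⟨a', rfl⟩ := Nat.exists_eq_add_of_le' ha
  generalize 11 ^ (a' + 1) = X at *
  have hd := pellHorner_mul_eq X (a' + 1)
  have hX : 1 ≤ X := by lia
  have hc : pellTwo (a' + 1) ≤ X * pellTwo (a' + 1 + 1) := by nlinarith
  have hc' : 4 * X + (X * pellTwo (a' + 1 + 1) - pellTwo (a' + 1)) ≤ X ^ 2 := by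
    have : X * pellTwo (a' + 1 + 1) + 4 * X ≤ X ^ 2 := by nlinarith
    lia
  refine ⟨pellHorner X (a' + 1), X * pellTwo (a' + 1 + 1) - pellTwo (a' + 1),
    X ^ 2 - (4 * X + (X * pellTwo (a' + 1 + 1) - pellTwo (a' + 1))), pellHorner X a',
    X - pellTwo (a' + 1) - 1, ?_, by lia, rfl, by lia⟩
  zify [hc]
  linear_combination -hd

/-- In `X^(a+2) + 4Xb = 2X^(a+1) + X²b + b + c` with `4X + c ≤ X²`, the numbers `b` and `c` are
quotient and remainder of a division by `X² - 4X + 1`. -/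
theorem division_unique {X A B b c b' c' : ℕ}
    (h : A + 4 * (X * b) = B + X ^ 2 * b + b + c) (hc : 4 * X + c ≤ X ^ 2)
    (h' : A + 4 * (X * b') = B + X ^ 2 * b' + b' + c') (hc' : 4 * X + c' ≤ X ^ 2) :
    b = b' ∧ c = c' := by
  obtain ⟨D, hD⟩ := Nat.exists_eq_add_of_le (show 4 * X ≤ X ^ 2 by lia)
  rw [hD] at h h'
  have h1 : A = B + ((D + 1) * b + c) := by linarith
  have h1' : A = B + ((D + 1) * b' + c') := by linarith
  have h2 : (D + 1) * b + c = (D + 1) * b' + c' := by lia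
  have hb : b = b' := by
    have := congrArg (· / (D + 1)) h2
    simpa [Nat.mul_add_div, Nat.div_eq_of_lt (show c < D + 1 by lia),
      Nat.div_eq_of_lt (show c' < D + 1 by lia)] using this
  subst hb
  exact ⟨rfl, by lia⟩

/-! ### The single-fold definition -/

theorem sum_sixteen_sq_eq_zero {A₁ A₂ A₃ A₄ A₅ A₆ A₇ A₈ A₉ A₁₀ A₁₁ A₁₂ A₁₃ A₁₄ A₁₅ A₁₆ : ℤ}
    (h : A₁ ^ 2 + A₂ ^ 2 + A₃ ^ 2 + A₄ ^ 2 + A₅ ^ 2 + A₆ ^ 2 + A₇ ^ 2 + A₈ ^ 2 + A₉ ^ 2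
      + A₁₀ ^ 2 + A₁₁ ^ 2 + A₁₂ ^ 2 + A₁₃ ^ 2 + A₁₄ ^ 2 + A₁₅ ^ 2 + A₁₆ ^ 2 = 0) :
    A₁ = 0 ∧ A₂ = 0 ∧ A₃ = 0 ∧ A₄ = 0 ∧ A₅ = 0 ∧ A₆ = 0 ∧ A₇ = 0 ∧ A₈ = 0 ∧ A₉ = 0 ∧
      A₁₀ = 0 ∧ A₁₁ = 0 ∧ A₁₂ = 0 ∧ A₁₃ = 0 ∧ A₁₄ = 0 ∧ A₁₅ = 0 ∧ A₁₆ = 0 := by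
  have key : ∀ {x y : ℤ}, 0 ≤ x → x + y ^ 2 = 0 → x = 0 ∧ y = 0 := by
    intro x y hx hxy
    have := sq_nonneg y
    exact ⟨by lia, by simpa using (show y ^ 2 = 0 by lia)⟩
  obtain ⟨h, h16⟩ := key (by positivity) h
  obtain ⟨h, h15⟩ := key (by positivity) h
  obtain ⟨h, h14⟩ := key (by positivity) h
  obtain ⟨h, h13⟩ := key (by positivity) h
  obtain ⟨h, h12⟩ := key (by positivity) h
  obtain ⟨h, h11⟩ := key (by positivity) h
  obtain ⟨h, h10⟩ := key (by positivity) h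
  obtain ⟨h, h9⟩ := key (by positivity) h
  obtain ⟨h, h8⟩ := key (by positivity) h
  obtain ⟨h, h7⟩ := key (by positivity) h
  obtain ⟨h, h6⟩ := key (by positivity) h
  obtain ⟨h, h5⟩ := key (by positivity) h
  obtain ⟨h, h4⟩ := key (by positivity) h
  obtain ⟨h, h3⟩ := key (by positivity) h
  obtain ⟨h, h2⟩ := key (by positivity) h
  exact ⟨by simpa using h, h2, h3, h4, h5, h6, h7, h8, h9, h10, h11, h12, h13, h14, h15, h16⟩

/-- The sum of squares vanishes exactly if all its terms do. -/
theorem mersenneSumOfSquares_eq_zero_iff {n k v a b c d e f g h i j q l m p x y z : ℕ} :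
    mersenneSumOfSquares n k v a b c d e f g h i j q l m p x y z = 0 ↔
      a = 2 ^ k ∧ f = 2 ^ (2 * k) ∧ g = 11 ^ (f + 2 * a) ∧ h = 11 ^ (f + a) ∧ i = 11 ^ a ∧
      j = 11 ^ (2 * a) ∧ q = 11 ^ (2 * a) * b ∧ l = 11 ^ a * b ∧ m = 11 ^ a * e ∧
      p = 2 ^ (k + 2) * z ∧ g + 4 * l = 2 * h + q + b + c ∧ j = 4 * i + c + d ∧ b = m + x ∧
      i = x + y + 1 ∧ p = x + z ∧ n = k + v := by
  have two_pow : ∀ {r s : ℕ}, (2 : ℤ) ^ r - 2 ^ s = 0 ↔ r = s := by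
    intro r s
    rw [sub_eq_zero]
    exact (pow_right_injective₀ (by norm_num) (by norm_num)).eq_iff
  constructor
  · intro H
    obtain ⟨h1, h2, h3, h4, h5, h6, h7, h8, h9, h10, h11, h12, h13, h14, h15, h16⟩ :=
      sum_sixteen_sq_eq_zero H
    rw [two_pow] at h11 h12 h13 h14 h15 h16
    rw [sub_eq_zero] at h1 h2 h3 h4 h5 h6 h7 h8 h9 h10
    exact ⟨mod_cast h1, mod_cast h2, mod_cast h3, mod_cast h4, mod_cast h5, mod_cast h6,
      mod_cast h7, mod_cast h8, mod_cast h9, mod_cast h10, h11, h12, h13, h14, h15, h16⟩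
  · rintro ⟨h1, h2, h3, h4, h5, h6, h7, h8, h9, h10, h11, h12, h13, h14, h15, h16⟩
    rw [mersenneSumOfSquares, two_pow.2 h11, two_pow.2 h12, two_pow.2 h13, two_pow.2 h14,
      two_pow.2 h15, two_pow.2 h16, h1, h2, h3, h4, h5, h6, h7, h8, h9, h10]
    push_cast
    rw [← h1, ← h2]
    ring

theorem two_pow_two_mul (k : ℕ) : 2 ^ (2 * k) = 2 ^ k * 2 ^ k := by rw [two_mul, pow_add]

/-- The system of equations with `X = 11^(2^k)` substituted for the unknowns that are powers
of `X`. -/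
theorem mersenneSumOfSquares_eq_zero_iff' {n k v a b c d e f g h i j q l m p x y z X : ℕ}
    (hX : X = 11 ^ 2 ^ k) :
    mersenneSumOfSquares n k v a b c d e f g h i j q l m p x y z = 0 ↔
      (a = 2 ^ k ∧ f = 2 ^ (2 * k) ∧ g = X ^ (2 ^ k + 2) ∧ h = X ^ (2 ^ k + 1) ∧ i = X ∧
        j = X ^ 2 ∧ q = X ^ 2 * b ∧ l = X * b ∧ m = X * e ∧ p = 2 ^ (k + 2) * z) ∧
      X ^ (2 ^ k + 2) + 4 * (X * b) = 2 * X ^ (2 ^ k + 1) + X ^ 2 * b + b + c ∧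
      X ^ 2 = 4 * X + c + d ∧ b = X * e + x ∧ X = x + y + 1 ∧
      2 ^ (k + 2) * z = x + z ∧ n = k + v := by
  have e1 : 11 ^ (2 ^ (2 * k) + 2 * 2 ^ k) = X ^ (2 ^ k + 2) := by
    rw [hX, ← pow_mul, two_pow_two_mul]; ring_nf
  have e2 : 11 ^ (2 ^ (2 * k) + 2 ^ k) = X ^ (2 ^ k + 1) := by
    rw [hX, ← pow_mul, two_pow_two_mul]; ring_nf
  have e3 : 11 ^ (2 * 2 ^ k) = X ^ 2 := by rw [hX, ← pow_mul, mul_comm]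
  rw [mersenneSumOfSquares_eq_zero_iff]
  constructor
  · rintro ⟨rfl, rfl, rfl, rfl, rfl, rfl, rfl, rfl, rfl, rfl, h11, h12, h13, h14, h15, h16⟩
    rw [e1, e2, e3, ← hX] at *
    exact ⟨⟨rfl, rfl, rfl, rfl, rfl, rfl, rfl, rfl, rfl, rfl⟩, h11, h12, h13, h14, h15, h16⟩
  · rintro ⟨⟨rfl, rfl, rfl, rfl, rfl, rfl, rfl, rfl, rfl, rfl⟩, h11, h12, h13, h14, h15, h16⟩
    rw [e1, e2, e3, ← hX]
    exact ⟨rfl, rfl, rfl, rfl, rfl, rfl, rfl, rfl, rfl, rfl, h11, h12, h13, h14, h15, h16⟩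

theorem quotient_remainder_unique {X e x e' x' : ℕ} (hx : x < X) (hx' : x' < X)
    (h : X * e + x = X * e' + x') : e = e' ∧ x = x' := by
  have he : e = e' := by
    have := congrArg (· / X) h
    simpa [Nat.mul_add_div (show X > 0 by lia), Nat.div_eq_of_lt hx, Nat.div_eq_of_lt hx']
      using this
  subst he
  exact ⟨rfl, by lia⟩

/-- At most one zero of the sum of squares has a given first coordinate. -/
theorem mersenneSumOfSquares_unique {n k v a b c d e f g h i j q l m p x y z : ℕ}
    {v' a' b' c' d' e' f' g' h' i' j' q' l' m' p' x' y' z' : ℕ}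
    (H : mersenneSumOfSquares n k v a b c d e f g h i j q l m p x y z = 0)
    (H' : mersenneSumOfSquares n k v' a' b' c' d' e' f' g' h' i' j' q' l' m' p' x' y' z' = 0) :
    v = v' ∧ a = a' ∧ b = b' ∧ c = c' ∧ d = d' ∧ e = e' ∧ f = f' ∧ g = g' ∧ h = h' ∧ i = i' ∧
      j = j' ∧ q = q' ∧ l = l' ∧ m = m' ∧ p = p' ∧ x = x' ∧ y = y' ∧ z = z' := by
  rw [mersenneSumOfSquares_eq_zero_iff' rfl] at H H'
  obtain ⟨⟨rfl, rfl, rfl, rfl, rfl, rfl, rfl, rfl, rfl, rfl⟩, h11, h12, h13, h14, h15, h16⟩ := H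
  obtain ⟨⟨rfl, rfl, rfl, rfl, rfl, rfl, rfl, rfl, rfl, rfl⟩, k11, k12, k13, k14, k15, k16⟩ := H'
  generalize 11 ^ 2 ^ k = X at *
  obtain ⟨rfl, rfl⟩ := division_unique h11 (by lia) k11 (by lia)
  obtain ⟨rfl, rfl⟩ := quotient_remainder_unique (by lia) (by lia) (h13.symm.trans k13)
  have hz : z = z' := by
    have h4 : 4 ≤ 2 ^ (k + 2) := by
      rw [pow_add]
      have : 1 ≤ 2 ^ k := Nat.one_le_two_pow
      lia
    obtain ⟨r, hr⟩ := Nat.exists_eq_add_of_le h4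
    rw [hr] at h15 k15
    have : (r + 3) * z = (r + 3) * z' := by linarith
    exact Nat.eq_of_mul_eq_mul_left (by lia) this
  subst hz
  refine ⟨?_, rfl, rfl, rfl, ?_, rfl, rfl, rfl, rfl, rfl, rfl, rfl, rfl, rfl, rfl, rfl, ?_, rfl⟩ <;>
    lia

/-- The vector of unknowns in the order in which `mersenneR` reads them. -/
def mersenneVec (k v a b c d e f g h i j q l m p x y z : ℕ) : Fin 19 → ℕ :=
  ![k, v, a, b, c, d, e, f, g, h, i, j, q, l, m, p, x, y, z]

theorem mersenneR_mersenneVec (n k v a b c d e f g h i j q l m p x y z : ℕ) :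
    mersenneR n (mersenneVec k v a b c d e f g h i j q l m p x y z)
      = mersenneSumOfSquares n k v a b c d e f g h i j q l m p x y z := rfl

theorem mersenneR_unique {n : ℕ} {u u' : Fin 19 → ℕ} (h0 : u 0 = u' 0) (hu : mersenneR n u = 0)
    (hu' : mersenneR n u' = 0) : u = u' := by
  rw [mersenneR] at hu hu'
  rw [← h0] at hu'
  have H := mersenneSumOfSquares_unique hu hu'
  funext s
  fin_cases s
  · exact h0
  all_goals simp only [Fin.mk_one, Fin.reduceFinMk, H]

/-- A solution exists exactly if the quotient `b` has a last digit, in base `X = 11^(2^k)`, that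
is divisible by `2^(k+2) - 1`; this last digit is `pellTwo (2^k)`. -/
theorem mersenneR_solvable_iff (n k : ℕ) :
    (1 ≤ k ∧ k ≤ n ∧ Nat.Prime (2 ^ (k + 2) - 1)) ↔
      ∃ u : Fin 19 → ℕ, u 0 = k ∧ mersenneR n u = 0 := by
  obtain ⟨b, c, d, e, y, hb, hc, he, hy⟩ := exists_pellTwo_division (a := 2 ^ k)
    Nat.one_le_two_pow
  have hz : ∀ z : ℕ, 2 ^ (k + 2) * z = pellTwo (2 ^ k) + z
      ↔ pellTwo (2 ^ k) = (2 ^ (k + 2) - 1) * z := by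
    intro z
    obtain ⟨r, hr⟩ := Nat.exists_eq_add_of_le' (Nat.one_le_two_pow (n := k + 2))
    rw [hr, Nat.add_sub_cancel, add_mul, one_mul, Nat.add_right_cancel_iff, eq_comm]
  have hp := one_le_and_prime_iff_dvd_pellTwo k
  constructor
  · rintro ⟨h1, hkn, hprime⟩
    obtain ⟨z, hz'⟩ := hp.1 ⟨h1, hprime⟩
    obtain ⟨v, hv⟩ := Nat.exists_eq_add_of_le hkn
    let X := 11 ^ 2 ^ k
    have H : mersenneSumOfSquares n k v (2 ^ k) b c d e (2 ^ (2 * k)) (X ^ (2 ^ k + 2))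
        (X ^ (2 ^ k + 1)) X (X ^ 2) (X ^ 2 * b) (X * b) (X * e) (2 ^ (k + 2) * z)
        (pellTwo (2 ^ k)) y z = 0 :=
      (mersenneSumOfSquares_eq_zero_iff' rfl).2
        ⟨⟨rfl, rfl, rfl, rfl, rfl, rfl, rfl, rfl, rfl, rfl⟩, hb, hc, he, hy, (hz z).2 hz', hv⟩
    rw [← mersenneR_mersenneVec] at H
    exact ⟨_, rfl, H⟩
  · rintro ⟨u, rfl, hu⟩
    rw [mersenneR, mersenneSumOfSquares_eq_zero_iff' rfl] at hu
    obtain ⟨-, h11, h12, h13, h14, h15, h16⟩ := hu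
    generalize 11 ^ 2 ^ u 0 = X at *
    obtain ⟨hbu, -⟩ := division_unique h11 (by lia) hb (by lia)
    obtain ⟨-, hx⟩ := quotient_remainder_unique (by lia) (by lia)
      (h13.symm.trans (hbu.trans he))
    rw [hx, hz] at h15
    obtain ⟨h1, h2⟩ := hp.2 (Dvd.intro _ h15.symm)
    exact ⟨h1, by lia, h2⟩

/-! ### Solutions in the box and the counting formula -/

/-- All unknowns of a solution, apart from `v`, stay below `X^(2^k + 3)` for `X = 11^(2^k)`, the
largest being `q ≤ 2 * X^(2^k + 2)`. -/
theorem mersenneSumOfSquares_bound {n k v a b c d e f g h i j q l m p x y z : ℕ} (hk : 1 ≤ k)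
    (H : mersenneSumOfSquares n k v a b c d e f g h i j q l m p x y z = 0) :
    ∀ s ∈ [k, a, b, c, d, e, f, g, h, i, j, q, l, m, p, x, y, z],
      s < (11 ^ 2 ^ k) ^ (2 ^ k + 3) := by
  rw [mersenneSumOfSquares_eq_zero_iff' rfl] at H
  obtain ⟨⟨rfl, rfl, rfl, rfl, rfl, rfl, rfl, rfl, rfl, rfl⟩, h11, h12, h13, h14, h15, -⟩ := H
  have hkX : 2 ^ k < 11 ^ 2 ^ k := Nat.lt_pow_self (by norm_num)
  have hkk : k < 2 ^ k := Nat.lt_two_pow_self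
  have hX : 121 ≤ 11 ^ 2 ^ k := by
    have h2 : 2 ≤ 2 ^ k := by simpa using Nat.pow_le_pow_right two_pos hk
    simpa using Nat.pow_le_pow_right (show 0 < 11 by norm_num) h2
  have hf : 2 ^ (2 * k) < (11 ^ 2 ^ k) ^ 2 := by
    rw [two_pow_two_mul, sq]
    exact Nat.mul_lt_mul'' hkX hkX
  have hz4 : 4 * z ≤ 2 ^ (k + 2) * z := by
    rw [pow_add]
    have : 1 ≤ 2 ^ k := Nat.one_le_two_pow
    exact Nat.mul_le_mul_right _ (by lia)
  generalize 11 ^ 2 ^ k = X at *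
  generalize 2 ^ k = a at *
  have hX1 : X ≤ X ^ (a + 2) := Nat.le_self_pow (by lia) X
  have hX2 : X ^ 2 ≤ X ^ (a + 2) := Nat.pow_le_pow_right (by lia) (by lia)
  have hX3 : X ^ (a + 1) ≤ X ^ (a + 2) := Nat.pow_le_pow_right (by lia) (by lia)
  have hX4 : X ^ (a + 3) = X * X ^ (a + 2) := by ring
  have hX5 : 3 * X ^ (a + 2) ≤ X * X ^ (a + 2) := Nat.mul_le_mul_right _ (by lia)
  have hX6 : X ^ 2 = X * X := sq X
  have hX7 : 2 * X ≤ X * X := Nat.mul_le_mul_right _ (by lia)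
  have hq1 : X * b ≤ X ^ 2 * b := Nat.mul_le_mul_right _ (by nlinarith)
  have hq2 : b ≤ X * b := Nat.le_mul_of_pos_left _ (by lia)
  have hq3 : 8 * (X * b) ≤ X ^ 2 * b := by
    rw [← mul_assoc]
    exact Nat.mul_le_mul_right _ (by nlinarith)
  have he : e ≤ X * e := Nat.le_mul_of_pos_left _ (by lia)
  simp only [List.forall_mem_cons, List.not_mem_nil, IsEmpty.forall_iff, implies_true, and_true]
  generalize X ^ (a + 3) = T at *
  generalize X ^ (a + 2) = T₂ at *
  generalize X ^ (a + 1) = T₁ at *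
  generalize X ^ 2 * b = q at *
  generalize X * b = l at *
  generalize X * e = m at *
  generalize X * T₂ = T₃ at *
  refine ⟨?_, ?_, ?_, ?_, ?_, ?_, ?_, ?_, ?_, ?_, ?_, ?_, ?_, ?_, ?_, ?_, ?_, ?_⟩ <;> lia

theorem lt_mersenneT (n : ℕ) : n < mersenneT n := by
  have h1 : n < 2 ^ n := Nat.lt_two_pow_self
  have h2 : 2 ^ n ≤ 2 ^ (2 * n + 1) := Nat.pow_le_pow_right two_pos (by lia)
  have h3 : 2 ^ (2 * n + 1) < 11 ^ 2 ^ (2 * n + 1) := Nat.lt_pow_self (by norm_num)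
  rw [mersenneT]
  lia

/-- For `n ≥ 2` the box `{0, …, t(n) - 1}^19` contains all zeros of `R(n, ·)`. -/
theorem lt_mersenneT_of_mersenneR_eq_zero {n : ℕ} (hn : 2 ≤ n) {u : Fin 19 → ℕ}
    (hu : mersenneR n u = 0) (s : Fin 19) : u s < mersenneT n := by
  obtain ⟨hk, hkn, -⟩ := (mersenneR_solvable_iff n (u 0)).2 ⟨u, rfl, hu⟩
  have hle : (11 ^ 2 ^ u 0) ^ (2 ^ u 0 + 3) ≤ mersenneT n := by
    rw [mersenneT, ← pow_mul]
    refine Nat.pow_le_pow_right (by norm_num) ?_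
    have h2n : 2 ^ (2 * n + 1) = 2 * (2 ^ n * 2 ^ n) := by rw [pow_succ, two_pow_two_mul, mul_comm]
    rw [h2n]
    have hmono : 2 ^ u 0 ≤ 2 ^ n := Nat.pow_le_pow_right two_pos hkn
    have h4n : 4 ≤ 2 ^ n := by simpa using Nat.pow_le_pow_right two_pos hn
    -- `a² + 3a ≤ 2a²` fails for `a = 2`, where `n ≥ 2` has to help out.
    rcases Nat.lt_or_ge (u 0) 2 with h | h
    · obtain h1 : u 0 = 1 := by lia
      rw [h1]
      nlinarith
    · have h4 : 4 ≤ 2 ^ u 0 := by simpa using Nat.pow_le_pow_right two_pos h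
      nlinarith
  have H := mersenneSumOfSquares_bound hk hu
  simp only [List.forall_mem_cons, List.not_mem_nil, IsEmpty.forall_iff, implies_true,
    and_true] at H
  have hv : u 1 < mersenneT n := by
    have h := (mersenneSumOfSquares_eq_zero_iff.1 hu).2.2.2.2.2.2.2.2.2.2.2.2.2.2.2
    have := lt_mersenneT n
    lia
  obtain ⟨h0, h2, h3, h4, h5, h6, h7, h8, h9, h10, h11, h12, h13, h14, h15, h16, h17, h18⟩ := H
  fin_cases s
  exacts [h0.trans_le hle, hv, h2.trans_le hle, h3.trans_le hle, h4.trans_le hle,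
    h5.trans_le hle, h6.trans_le hle, h7.trans_le hle, h8.trans_le hle, h9.trans_le hle,
    h10.trans_le hle, h11.trans_le hle, h12.trans_le hle, h13.trans_le hle, h14.trans_le hle,
    h15.trans_le hle, h16.trans_le hle, h17.trans_le hle, h18.trans_le hle]

theorem mersenneR_nonneg (n : ℕ) (u : Fin 19 → ℕ) : 0 ≤ mersenneR n u := by
  rw [mersenneR, mersenneSumOfSquares]
  positivity

theorem sq_sub_le_four_pow {x y s : ℕ} (hx : x ≤ 2 ^ s) (hy : y ≤ 2 ^ s) :
    ((x : ℤ) - y) ^ 2 ≤ 4 ^ s := by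
  have h4 : (4 : ℤ) ^ s = (2 ^ s) ^ 2 := by rw [← pow_mul, mul_comm, pow_mul]; norm_num
  rw [h4, sq_le_sq, abs_of_nonneg (show (0 : ℤ) ≤ 2 ^ s by positivity), abs_le]
  have hx' : (x : ℤ) ≤ 2 ^ s := by exact_mod_cast hx
  have hy' : (y : ℤ) ≤ 2 ^ s := by exact_mod_cast hy
  constructor <;> lia

/-- On the box no term of the sum of squares exceeds `(2^(12t))²`. -/
theorem mersenneSumOfSquares_le {n k v a b c d e f g h i j q l m p x y z t : ℕ} (hn : n < t)
    (hk : k < t) (hv : v < t) (ha : a < t) (hb : b < t) (hc : c < t) (hd : d < t) (he : e < t)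
    (hf : f < t) (hg : g < t) (hh : h < t) (hi : i < t) (hj : j < t) (hq : q < t) (hl : l < t)
    (hm : m < t) (hp : p < t) (hx : x < t) (hy : y < t) (hz : z < t) :
    mersenneSumOfSquares n k v a b c d e f g h i j q l m p x y z ≤ 2 ^ (36 * t + 6) := by
  have hvar : ∀ {r : ℕ}, r < t → r ≤ 2 ^ t := fun hr =>
    hr.le.trans Nat.lt_two_pow_self.le
  have htwo : ∀ {r : ℕ}, r ≤ 12 * t → 2 ^ r ≤ 2 ^ (12 * t) := fun hr =>
    Nat.pow_le_pow_right two_pos hr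
  have hvar' : ∀ {r : ℕ}, r < t → r ≤ 2 ^ (12 * t) := fun hr =>
    (hvar hr).trans (htwo (by lia))
  have heleven : ∀ {r s : ℕ}, 4 * r ≤ s → 11 ^ r ≤ 2 ^ s := by
    intro r s hr
    calc 11 ^ r ≤ 16 ^ r := Nat.pow_le_pow_left (by norm_num) r
      _ = 2 ^ (4 * r) := by rw [pow_mul]; norm_num
      _ ≤ 2 ^ s := Nat.pow_le_pow_right two_pos hr
  have hmul : ∀ {r s : ℕ}, r ≤ 2 ^ (8 * t) → s < t → r * s ≤ 2 ^ (12 * t) := by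
    intro r s hr hs
    calc r * s ≤ 2 ^ (8 * t) * 2 ^ t := Nat.mul_le_mul hr (hvar hs)
      _ = 2 ^ (8 * t + t) := (pow_add _ _ _).symm
      _ ≤ 2 ^ (12 * t) := htwo (by lia)
  have b1 := sq_sub_le_four_pow (hvar' ha) (htwo (r := k) (by lia))
  have b2 := sq_sub_le_four_pow (hvar' hf) (htwo (r := 2 * k) (by lia))
  have b3 := sq_sub_le_four_pow (hvar' hg) (heleven (r := f + 2 * a) (s := 12 * t) (by lia))
  have b4 := sq_sub_le_four_pow (hvar' hh) (heleven (r := f + a) (s := 12 * t) (by lia))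
  have b5 := sq_sub_le_four_pow (hvar' hi) (heleven (r := a) (s := 12 * t) (by lia))
  have b6 := sq_sub_le_four_pow (hvar' hj) (heleven (r := 2 * a) (s := 12 * t) (by lia))
  have b7 := sq_sub_le_four_pow (hvar' hq) (hmul (heleven (r := 2 * a) (by lia)) hb)
  have b8 := sq_sub_le_four_pow (hvar' hl) (hmul (heleven (r := a) (by lia)) hb)
  have b9 := sq_sub_le_four_pow (hvar' hm) (hmul (heleven (r := a) (by lia)) he)
  have b10 := sq_sub_le_four_pow (hvar' hp)
    (hmul (Nat.pow_le_pow_right two_pos (show k + 2 ≤ 8 * t by lia)) hz)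
  have b11 := sq_sub_le_four_pow (htwo (r := g + 4 * l) (by lia))
    (htwo (r := 2 * h + q + b + c) (by lia))
  have b12 := sq_sub_le_four_pow (htwo (r := j) (by lia)) (htwo (r := 4 * i + c + d) (by lia))
  have b13 := sq_sub_le_four_pow (htwo (r := b) (by lia)) (htwo (r := m + x) (by lia))
  have b14 := sq_sub_le_four_pow (htwo (r := i) (by lia)) (htwo (r := x + y + 1) (by lia))
  have b15 := sq_sub_le_four_pow (htwo (r := p) (by lia)) (htwo (r := x + z) (by lia))
  have b16 := sq_sub_le_four_pow (htwo (r := n) (by lia)) (htwo (r := k + v) (by lia))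
  have hfinal : 16 * (4 : ℤ) ^ (12 * t) ≤ 2 ^ (36 * t + 6) := by
    have h4 : 16 * (4 : ℤ) ^ (12 * t) = 2 ^ (24 * t + 4) := by
      rw [show (4 : ℤ) = 2 ^ 2 by norm_num, ← pow_mul, pow_add, mul_comm]
      ring_nf
    rw [h4]
    exact pow_le_pow_right₀ (by norm_num) (by lia)
  refine le_trans ?_ hfinal
  push_cast at b1 b2 b3 b4 b5 b6 b7 b8 b9 b10 b11 b12 b13 b14 b15 b16
  rw [mersenneSumOfSquares]
  linarith

theorem mersenneR_le (n : ℕ) (u : Fin 19 → Fin (mersenneT n)) :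
    mersenneR n (fun s => (u s : ℕ)) ≤ 2 ^ mersenneW n :=
  mersenneSumOfSquares_le (lt_mersenneT n) (u 0).2 (u 1).2 (u 2).2 (u 3).2 (u 4).2 (u 5).2
    (u 6).2 (u 7).2 (u 8).2 (u 9).2 (u 10).2 (u 11).2 (u 12).2 (u 13).2 (u 14).2 (u 15).2
    (u 16).2 (u 17).2 (u 18).2

/-- The zeros of `R(n, ·)` in the box `{0, …, t(n) - 1}^19`. -/
def mersenneZeros (n : ℕ) : Finset (Fin 19 → Fin (mersenneT n)) :=
  Finset.univ.filter fun u => mersenneR n (fun s => (u s : ℕ)) = 0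

theorem hammingWeight_mersenneM (n : ℕ) :
    hammingWeight (mazzantiM (mersenneR n) (mersenneT n) (mersenneW n)).toNat
      = mersenneW n * (mersenneT n ^ 19 + (mersenneZeros n).card) :=
  hammingWeight_mazzantiM (fun _ => mersenneR_nonneg _ _) (mersenneR_le n)

theorem mersenneW_pos (n : ℕ) : 0 < mersenneW n := by rw [mersenneW]; lia

theorem mersenneFormula_eq (n : ℕ) : mersenneFormula n = ((mersenneZeros n).card + 1 : ℕ) := by
  have hw : (mersenneW n : ℚ) ≠ 0 := by exact_mod_cast (mersenneW_pos n).ne'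
  rw [mersenneFormula, hammingWeight_mersenneM]
  push_cast
  rw [mul_div_cancel_left₀ _ hw]
  ring

/-- The summand `1` stands for `k = 0`, that is, for the Mersenne prime `3`. -/
theorem mersenneCount_eq (n : ℕ) (hn : n ≠ 1) :
    mersenneCount n = (mersenneZeros n).card + 1 := by
  have h0 : Nat.Prime (2 ^ (0 + 2) - 1) := by norm_num
  have hcard : (mersenneZeros n).card
      = ((Finset.range n).filter fun k => Nat.Prime (2 ^ (k + 1 + 2) - 1)).card := by
    have hmem : ∀ u ∈ mersenneZeros n, mersenneR n (fun s => (u s : ℕ)) = 0 := fun u hu => by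
      simpa [mersenneZeros] using hu
    refine Finset.card_bij (fun u _ => (u 0 : ℕ) - 1) ?_ ?_ ?_
    · intro u hu
      obtain ⟨h1, h2, h3⟩ := (mersenneR_solvable_iff n (u 0)).2 ⟨_, rfl, hmem u hu⟩
      rw [Finset.mem_filter, Finset.mem_range, Nat.sub_add_cancel h1]
      exact ⟨by lia, h3⟩
    · intro u hu u' hu' huu'
      have h1 := ((mersenneR_solvable_iff n (u 0)).2 ⟨_, rfl, hmem u hu⟩).1
      have h1' := ((mersenneR_solvable_iff n (u' 0)).2 ⟨_, rfl, hmem u' hu'⟩).1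
      have h := mersenneR_unique (show (u 0 : ℕ) = u' 0 by lia) (hmem u hu) (hmem u' hu')
      funext s
      exact Fin.ext (congrFun h s)
    · intro k hk
      rw [Finset.mem_filter, Finset.mem_range] at hk
      obtain ⟨u, hu0, hu⟩ := (mersenneR_solvable_iff n (k + 1)).1 ⟨by lia, by lia, hk.2⟩
      refine ⟨fun s => ⟨u s, lt_mersenneT_of_mersenneR_eq_zero (by lia) hu s⟩, ?_, ?_⟩
      · simpa [mersenneZeros] using hu
      · simp [hu0]
  rw [mersenneCount, hcard, Finset.card_filter, Finset.card_filter, Finset.sum_range_succ',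
    if_pos h0]

/-- For `n = 1` the only solution, with `k = 1`, lies outside of the box: its coordinate `g`
equals `11^8 = t(1)`. -/
theorem mersenneZeros_one : mersenneZeros 1 = ∅ := by
  rw [mersenneZeros, Finset.filter_eq_empty_iff]
  intro u _ hu
  obtain ⟨h1, h2, -⟩ := (mersenneR_solvable_iff 1 (u 0)).2 ⟨_, rfl, hu⟩
  have hk : (u 0 : ℕ) = 1 := le_antisymm h2 h1
  have hg := (mersenneSumOfSquares_eq_zero_iff' rfl).1 hu |>.1.2.2.1
  beta_reduce at hg
  rw [hk] at hg
  have := (u 8).2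
  have ht : mersenneT 1 = (11 ^ 2 ^ 1) ^ (2 ^ 1 + 2) := by norm_num [mersenneT]
  have hg' : (u 8 : ℕ) = mersenneT 1 := hg.trans ht.symm
  lia

theorem mersenneCount_one : mersenneCount 1 = 2 := by
  have h0 : Nat.Prime (2 ^ (0 + 2) - 1) := by norm_num
  have h1 : Nat.Prime (2 ^ (1 + 2) - 1) := by norm_num
  rw [mersenneCount, Finset.card_filter, Finset.sum_range_succ, Finset.sum_range_one, if_pos h0,
    if_pos h1]

/-! ### Functions given by arithmetic terms -/

/-- `F` is the value of an arithmetic term in one variable that is defined everywhere. -/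
def IsArith (F : ℕ → ℕ) : Prop :=
  ∃ T : ArithTerm 1, ∀ n : ℕ, T.IsDefinedAt ![n] ∧ T.eval ![n] = F n

namespace IsArith

variable {F G : ℕ → ℕ}

theorem const (c : ℕ) : IsArith fun _ => c := ⟨.const c, fun _ => ⟨trivial, rfl⟩⟩

theorem id : IsArith fun n => n := ⟨.var 0, fun _ => ⟨trivial, rfl⟩⟩

theorem add (hF : IsArith F) (hG : IsArith G) : IsArith fun n => F n + G n := by
  obtain ⟨S, hS⟩ := hF
  obtain ⟨T, hT⟩ := hG
  exact ⟨.add S T, fun n => ⟨⟨(hS n).1, (hT n).1⟩, congrArg₂ _ (hS n).2 (hT n).2⟩⟩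

theorem sub (hF : IsArith F) (hG : IsArith G) : IsArith fun n => F n - G n := by
  obtain ⟨S, hS⟩ := hF
  obtain ⟨T, hT⟩ := hG
  exact ⟨.monus S T, fun n => ⟨⟨(hS n).1, (hT n).1⟩, congrArg₂ _ (hS n).2 (hT n).2⟩⟩

theorem mul (hF : IsArith F) (hG : IsArith G) : IsArith fun n => F n * G n := by
  obtain ⟨S, hS⟩ := hF
  obtain ⟨T, hT⟩ := hG
  exact ⟨.mul S T, fun n => ⟨⟨(hS n).1, (hT n).1⟩, congrArg₂ _ (hS n).2 (hT n).2⟩⟩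

theorem div (hF : IsArith F) (hG : IsArith G) (h0 : ∀ n, G n ≠ 0) :
    IsArith fun n => F n / G n := by
  obtain ⟨S, hS⟩ := hF
  obtain ⟨T, hT⟩ := hG
  exact ⟨.floorDiv S T, fun n =>
    ⟨⟨(hS n).1, (hT n).1, (hT n).2.trans_ne (h0 n)⟩, congrArg₂ _ (hS n).2 (hT n).2⟩⟩

theorem two_pow (hF : IsArith F) : IsArith fun n => 2 ^ F n := by
  obtain ⟨S, hS⟩ := hF
  exact ⟨.twoPow S, fun n => ⟨(hS n).1, congrArg _ (hS n).2⟩⟩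

theorem mod (hF : IsArith F) (hG : IsArith G) (h0 : ∀ n, G n ≠ 0) :
    IsArith fun n => F n % G n := by
  have h : (fun n => F n % G n) = fun n => F n - G n * (F n / G n) :=
    funext fun n => Nat.mod_def (F n) (G n)
  rw [h]
  exact hF.sub (hG.mul (hF.div hG h0))

end IsArith

/-- `2^z ≡ x` modulo `2^z - x`, so `2^(zy)` leaves the remainder `x^y` as soon as
`x^y < 2^z - x`, for which `z = xy + x + 1` is large enough. -/
theorem pow_eq_two_pow_mod (x y : ℕ) :
    x ^ y = 2 ^ ((x * y + x + 1) * y) % (2 ^ (x * y + x + 1) - x) ∧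
      2 ^ (x * y + x + 1) - x ≠ 0 := by
  have h1 : x ^ y ≤ 2 ^ (x * y) := by
    rw [pow_mul]
    exact Nat.pow_le_pow_left Nat.lt_two_pow_self.le y
  have h2 : x < 2 ^ x := Nat.lt_two_pow_self
  have h3 : 2 ^ (x * y) ≤ 2 ^ (x * y + x) := Nat.pow_le_pow_right two_pos (by lia)
  have h4 : 2 ^ x ≤ 2 ^ (x * y + x) := Nat.pow_le_pow_right two_pos (by lia)
  have h5 : 2 ^ (x * y + x + 1) = 2 ^ (x * y + x) * 2 := pow_succ _ _
  have hlt : x ^ y < 2 ^ (x * y + x + 1) - x := by lia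
  refine ⟨?_, by lia⟩
  have hmod : 2 ^ (x * y + x + 1) ≡ x [MOD 2 ^ (x * y + x + 1) - x] :=
    ((Nat.modEq_iff_dvd' (by lia)).2 dvd_rfl).symm
  rw [pow_mul, (hmod.pow y), Nat.mod_eq_of_lt hlt]

/-- In a base `Z` greater than the number of summands there are no carries, so the digits of
`∑ s ∈ S, Z^(e s)` count the fibres of `e`. -/
theorem sum_pow_div_mod_eq_card {ι : Type*} (S : Finset ι) (e : ι → ℕ) {Z : ℕ} (hZ : S.card < Z)
    (j : ℕ) : (∑ s ∈ S, Z ^ e s) / Z ^ j % Z = (S.filter fun s => e s = j).card := by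
  classical
  have hZ0 : 0 < Z := by lia
  have hlow : ∑ s ∈ S with e s < j, Z ^ e s < Z ^ j := by
    rcases Nat.eq_zero_or_pos j with rfl | hj
    · simp
    · obtain ⟨i, rfl⟩ := Nat.exists_eq_add_of_le' hj
      calc ∑ s ∈ S with e s < i + 1, Z ^ e s ≤ ∑ s ∈ S with e s < i + 1, Z ^ i := by
            refine Finset.sum_le_sum fun s hs => Nat.pow_le_pow_right hZ0 ?_
            have := (Finset.mem_filter.1 hs).2
            lia
        _ = (S.filter fun s => e s < i + 1).card * Z ^ i := by simp
        _ < Z * Z ^ i := Nat.mul_lt_mul_of_pos_right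
            ((Finset.card_filter_le _ _).trans_lt hZ) (by positivity)
        _ = Z ^ (i + 1) := by ring
  have hmid : ∑ s ∈ S with e s = j, Z ^ e s = Z ^ j * (S.filter fun s => e s = j).card := by
    rw [Finset.sum_congr rfl fun s hs => by rw [(Finset.mem_filter.1 hs).2]]
    simp [mul_comm]
  obtain ⟨H, hH⟩ : Z ^ j * Z ∣ ∑ s ∈ S with j < e s, Z ^ e s :=
    Finset.dvd_sum fun s hs => by
      rw [← pow_succ]
      exact pow_dvd_pow _ (Finset.mem_filter.1 hs).2
  have hsplit : ∑ s ∈ S, Z ^ e s = ∑ s ∈ S with e s < j, Z ^ e s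
      + ∑ s ∈ S with e s = j, Z ^ e s + ∑ s ∈ S with j < e s, Z ^ e s := by
    simp only [Finset.sum_filter, ← Finset.sum_add_distrib]
    refine Finset.sum_congr rfl fun s _ => ?_
    rcases lt_trichotomy (e s) j with h | h | h
    · simp [h, h.ne, h.not_gt]
    · simp [h]
    · simp [h, h.ne', h.not_gt]
  rw [hsplit, hmid, hH, show ∀ A c : ℕ, A + Z ^ j * c + Z ^ j * Z * H = A + Z ^ j * (c + Z * H)
      from fun A c => by ring, Nat.add_mul_div_left _ _ (by positivity), Nat.div_eq_of_lt hlow,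
    zero_add, Nat.add_mul_mod_self_left, Nat.mod_eq_of_lt ((Finset.card_filter_le _ _).trans_lt hZ)]

/-- The binomial theorem for `(Z + 1)^(2N)`, read off in base `Z = 2^(2N + 1)`. -/
theorem centralBinom_eq_div_mod (N : ℕ) :
    N.centralBinom = (2 ^ (2 * N + 1) + 1) ^ (2 * N) / (2 ^ (2 * N + 1)) ^ N
      % 2 ^ (2 * N + 1) := by
  have hbin := Finset.sum_pow_mul_eq_add_pow (2 ^ (2 * N + 1)) 1 (Finset.range (2 * N))
  simp only [one_pow, mul_one, Finset.card_range] at hbin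
  rw [← hbin, sum_pow_div_mod_eq_card _ _ (by simp [pow_succ]), ← Finset.powersetCard_eq_filter,
    Finset.card_powersetCard, Finset.card_range, Nat.centralBinom]

theorem sum_range_pow_eq_div {q : ℕ} (hq : 2 ≤ q) (t : ℕ) :
    ∑ j ∈ Finset.range t, q ^ j = (q ^ t - 1) / (q - 1) := Nat.geomSum_eq hq t

theorem card_filter_dvd_mul (a : ℕ) {b : ℕ} (hb : 0 < b) :
    ((Finset.range b).filter fun x => b ∣ a * x).card = Nat.gcd a b := by
  have hg : 0 < Nat.gcd b a := Nat.gcd_pos_of_pos_left _ hb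
  rw [Nat.gcd_comm]
  obtain ⟨b', hb'⟩ := Nat.gcd_dvd_left b a
  have hb0 : 0 < b' := Nat.pos_of_ne_zero fun h => by rw [h, mul_zero] at hb'; lia
  have hdvd : ∀ x, b ∣ a * x ↔ b' ∣ x := fun x => by
    conv_lhs => rw [← Nat.dvd_gcd_mul_iff_dvd_mul]
    generalize Nat.gcd b a = g at *
    rw [hb', Nat.mul_dvd_mul_iff_left hg]
  generalize Nat.gcd b a = g at *
  have himage : ((Finset.range b).filter fun x => b ∣ a * x)
      = (Finset.range g).image fun i => b' * i := by
    ext x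
    simp only [hdvd, Finset.mem_filter, Finset.mem_image, Finset.mem_range]
    constructor
    · rintro ⟨hx, i, rfl⟩
      rw [hb', mul_comm] at hx
      exact ⟨i, lt_of_mul_lt_mul_right hx (Nat.zero_le _), rfl⟩
    · rintro ⟨i, hi, rfl⟩
      rw [hb', mul_comm]
      exact ⟨Nat.mul_lt_mul_of_pos_right hi hb0, dvd_mul_left _ _⟩
  rw [himage, Finset.card_image_of_injective _ (mul_right_injective₀ hb0.ne'),
    Finset.card_range]

/-- The greatest common divisor counts the pairs `(x, y)` with `x < b`, `y < a` and
`a * x + b * (y + 1) = a * b`, and hence is a digit of a product of two geometric sums. -/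
theorem gcd_eq_div_mod {a b : ℕ} (ha : 0 < a) (hb : 0 < b) :
    Nat.gcd a b = ((2 ^ (a * b)) ^ (a * b) - 1) / ((2 ^ (a * b)) ^ a - 1)
        * (((2 ^ (a * b)) ^ (a * b) - 1) / ((2 ^ (a * b)) ^ b - 1))
      / (2 ^ (a * b)) ^ (a * b - b) % 2 ^ (a * b) := by
  have hab : a * b ≠ 0 := (Nat.mul_pos ha hb).ne'
  have hZ : 2 ≤ 2 ^ (a * b) := Nat.le_self_pow hab 2
  have hZlt : a * b < 2 ^ (a * b) := Nat.lt_two_pow_self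
  have hsum : ∀ Z : ℕ, 2 ≤ Z → (Z ^ (a * b) - 1) / (Z ^ a - 1) * ((Z ^ (a * b) - 1) / (Z ^ b - 1))
      = ∑ s ∈ Finset.range b ×ˢ Finset.range a, Z ^ (a * s.1 + b * s.2) := by
    intro Z hZ
    have h1 := sum_range_pow_eq_div (hZ.trans (Nat.le_self_pow ha.ne' Z)) b
    have h2 := sum_range_pow_eq_div (hZ.trans (Nat.le_self_pow hb.ne' Z)) a
    rw [← pow_mul] at h1 h2
    rw [mul_comm b a] at h2
    rw [← h1, ← h2, Finset.sum_mul_sum, ← Finset.sum_product']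
    simp only [← pow_mul, ← pow_add]
  rw [hsum _ hZ, sum_pow_div_mod_eq_card _ _ (by simpa [mul_comm] using hZlt),
    ← card_filter_dvd_mul a hb]
  symm
  refine Finset.card_bij (fun s _ => s.1) ?_ ?_ ?_
  · rintro ⟨x, y⟩ hs
    simp only [Finset.mem_filter, Finset.mem_product, Finset.mem_range] at hs ⊢
    refine ⟨hs.1.1, (Nat.dvd_add_left (dvd_mul_right b y)).1 ?_⟩
    rw [hs.2, ← Nat.sub_one_mul]
    exact dvd_mul_left _ _
  · rintro ⟨x, y⟩ hs ⟨x', y'⟩ hs' hx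
    simp only [Finset.mem_filter] at hs hs' hx
    obtain rfl := hx
    have h : b * y = b * y' := by lia
    rw [Nat.eq_of_mul_eq_mul_left hb h]
  · intro x hx
    simp only [Finset.mem_filter, Finset.mem_range] at hx
    obtain ⟨w, hw⟩ := hx.2
    have hwa : w < a := by
      have h := Nat.mul_lt_mul_of_pos_left hx.1 ha
      rw [hw, mul_comm a b] at h
      exact lt_of_mul_lt_mul_left h (Nat.zero_le _)
    obtain ⟨y, rfl⟩ := Nat.exists_eq_add_of_lt hwa
    refine ⟨(x, y), ?_, rfl⟩
    simp only [Finset.mem_filter, Finset.mem_product, Finset.mem_range]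
    refine ⟨⟨hx.1, by lia⟩, ?_⟩
    rw [hw]
    exact Nat.eq_sub_of_add_eq (by ring)

theorem gcd_two_pow_self {m : ℕ} (hm : m ≠ 0) : Nat.gcd m (2 ^ m) = 2 ^ padicValNat 2 m := by
  obtain ⟨v, r, hr, hmr⟩ := Nat.exists_eq_two_pow_mul_odd hm
  have hv : padicValNat 2 m = v := by
    rw [hmr, padicValNat.mul (by positivity) (by rintro rfl; simp at hr), padicValNat.prime_pow,
      padicValNat.eq_zero_of_not_dvd hr.not_two_dvd_nat, add_zero]
  have hvm : v ≤ m := by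
    have h1 : v < 2 ^ v := Nat.lt_two_pow_self
    have h2 : 2 ^ v ≤ m := Nat.le_of_dvd (Nat.pos_of_ne_zero hm) (hmr ▸ dvd_mul_right _ _)
    lia
  obtain ⟨s, hs⟩ := Nat.exists_eq_add_of_le hvm
  have hcop : Nat.Coprime r (2 ^ s) := (Nat.coprime_two_right.2 hr).pow_right s
  rw [hv]
  conv_lhs => rw [hs, pow_add, ← hs, hmr, Nat.gcd_mul_left, hcop.gcd_eq_one, mul_one]

/-- Modulo `Y²`, `(1 + Y)^v` is `1 + vY`. For `Y = 2^(L + 2) - 1` and `L = 2^v` the former is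
`L^(L + 2)`. -/
theorem eq_pow_mod_div (v : ℕ) :
    v = (2 ^ v) ^ (2 ^ v + 2) % (2 ^ (2 ^ v + 2) - 1) ^ 2 / (2 ^ (2 ^ v + 2) - 1) := by
  have hv : v < 2 ^ v := Nat.lt_two_pow_self
  have hL : 2 ^ v + 2 < 2 ^ (2 ^ v + 2) := Nat.lt_two_pow_self
  rw [← pow_mul, mul_comm v, pow_mul]
  generalize 2 ^ (2 ^ v + 2) = W at *
  obtain ⟨Y, rfl⟩ := Nat.exists_eq_add_of_le' (show 1 ≤ W by lia)
  rw [Nat.add_sub_cancel]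
  have hmod : ∀ v : ℕ, (Y + 1) ^ v ≡ v * Y + 1 [MOD Y ^ 2] := by
    intro v
    induction v with
    | zero => simpa using Nat.ModEq.refl 1
    | succ v ih =>
      rw [pow_succ]
      refine (ih.mul_right _).trans ?_
      have h : (v * Y + 1) * (Y + 1) = ((v + 1) * Y + 1) + Y ^ 2 * v := by ring
      rw [h]
      exact Nat.add_mul_mod_self_left _ _ _
  have hlt : v * Y + 1 < Y ^ 2 := by nlinarith
  rw [hmod v, Nat.mod_eq_of_lt hlt, add_comm, Nat.add_mul_div_right _ _ (by lia),
    Nat.div_eq_of_lt (by lia), zero_add]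

/-- Kummer's theorem for the prime `2`. -/
theorem hammingWeight_eq_padicValNat (N : ℕ) :
    hammingWeight N = padicValNat 2 N.centralBinom := by
  have h := sub_one_mul_padicValNat_choose_eq_sub_sum_digits' (p := 2) (k := N) (n := N)
  simp only [← hammingWeight_eq_sum_digits, ← two_mul, hammingWeight_two_mul] at h
  rw [Nat.centralBinom]
  lia

namespace IsArith

variable {F G : ℕ → ℕ}

theorem pow (hF : IsArith F) (hG : IsArith G) : IsArith fun n => F n ^ G n := by
  have h : (fun n => F n ^ G n) = fun n => 2 ^ ((F n * G n + F n + 1) * G n)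
      % (2 ^ (F n * G n + F n + 1) - F n) :=
    funext fun n => (pow_eq_two_pow_mod (F n) (G n)).1
  rw [h]
  have hz := ((hF.mul hG).add hF).add (const 1)
  exact (hz.mul hG).two_pow.mod (hz.two_pow.sub hF) fun n => (pow_eq_two_pow_mod (F n) (G n)).2

theorem centralBinom (hF : IsArith F) : IsArith fun n => (F n).centralBinom := by
  simp only [centralBinom_eq_div_mod]
  have hZ := (((const 2).mul hF).add (const 1)).two_pow
  exact (((hZ.add (const 1)).pow ((const 2).mul hF)).div (hZ.pow hF) fun n => by positivity).mod
    hZ fun n => by positivity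

theorem gcd (hF : IsArith F) (hG : IsArith G) (hF0 : ∀ n, 0 < F n) (hG0 : ∀ n, 0 < G n) :
    IsArith fun n => Nat.gcd (F n) (G n) := by
  have h := funext fun n => gcd_eq_div_mod (hF0 n) (hG0 n)
  rw [h]
  have hZ := (hF.mul hG).two_pow
  have hne : ∀ n m, 0 < m → (2 ^ (F n * G n)) ^ m - 1 ≠ 0 := fun n m hm => by
    have h2 : 2 ≤ 2 ^ (F n * G n) := Nat.le_self_pow (Nat.mul_pos (hF0 n) (hG0 n)).ne' 2
    have := h2.trans (Nat.le_self_pow hm.ne' _)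
    lia
  have hnum := (hZ.pow (hF.mul hG)).sub (const 1)
  exact (((hnum.div ((hZ.pow hF).sub (const 1)) fun n => hne n _ (hF0 n)).mul
    (hnum.div ((hZ.pow hG).sub (const 1)) fun n => hne n _ (hG0 n))).div
      (hZ.pow ((hF.mul hG).sub hG)) fun n => by positivity).mod hZ fun n => by positivity

/-- The exponent `F` is recovered from the power `2^F`. -/
theorem of_two_pow (hF : IsArith fun n => 2 ^ F n) : IsArith F := by
  have h : F = _ := funext fun n => eq_pow_mod_div (F n)
  rw [h]
  have hL := hF.add (const 2)
  have hY := hL.two_pow.sub (const 1)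
  have hne : ∀ n, 2 ^ (2 ^ F n + 2) - 1 ≠ 0 := fun n => by
    have : 2 ^ F n + 2 < 2 ^ (2 ^ F n + 2) := Nat.lt_two_pow_self
    lia
  exact ((hF.pow hL).mod (hY.pow (const 2)) fun n => pow_ne_zero 2 (hne n)).div hY hne

theorem hammingWeight (hF : IsArith F) : IsArith fun n => hammingWeight (F n) := by
  simp only [hammingWeight_eq_padicValNat]
  refine of_two_pow ?_
  simp only [← gcd_two_pow_self (Nat.centralBinom_ne_zero _)]
  exact hF.centralBinom.gcd hF.centralBinom.two_pow (fun n => Nat.centralBinom_pos _)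
    fun n => by positivity

end IsArith

/-! ### Sums of exponential polynomials over boxes -/

/-- A difference of two arithmetic terms. -/
def IsArithInt (F : ℕ → ℤ) : Prop :=
  ∃ P Q : ℕ → ℕ, IsArith P ∧ IsArith Q ∧ ∀ n, F n = P n - Q n

namespace IsArithInt

variable {F G : ℕ → ℤ}

theorem natCast {P : ℕ → ℕ} (hP : IsArith P) : IsArithInt fun n => P n :=
  ⟨P, _, hP, .const 0, fun n => by simp⟩

theorem add (hF : IsArithInt F) (hG : IsArithInt G) : IsArithInt fun n => F n + G n := by
  obtain ⟨P, Q, hP, hQ, h⟩ := hF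
  obtain ⟨P', Q', hP', hQ', h'⟩ := hG
  refine ⟨_, _, hP.add hP', hQ.add hQ', fun n => ?_⟩
  simp only [h, h']
  push_cast
  ring

theorem neg (hF : IsArithInt F) : IsArithInt fun n => -F n := by
  obtain ⟨P, Q, hP, hQ, h⟩ := hF
  exact ⟨Q, P, hQ, hP, fun n => by simp only [h]; ring⟩

theorem mul (hF : IsArithInt F) (hG : IsArithInt G) : IsArithInt fun n => F n * G n := by
  obtain ⟨P, Q, hP, hQ, h⟩ := hF
  obtain ⟨P', Q', hP', hQ', h'⟩ := hG
  refine ⟨_, _, (hP.mul hP').add (hQ.mul hQ'), (hP.mul hQ').add (hQ.mul hP'), fun n => ?_⟩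
  simp only [h, h']
  push_cast
  ring

theorem finsetProd {ι : Type*} (S : Finset ι) {F : ι → ℕ → ℤ} (hF : ∀ i, IsArithInt (F i)) :
    IsArithInt fun n => ∏ i ∈ S, F i n := by
  classical
  induction S using Finset.induction_on with
  | empty => simpa using natCast (.const 1)
  | insert i S hi ih =>
    simp only [Finset.prod_insert hi]
    exact (hF i).mul ih

theorem toNat (hF : IsArithInt F) : IsArith fun n => (F n).toNat := by
  obtain ⟨P, Q, hP, hQ, h⟩ := hF
  have : (fun n => (F n).toNat) = fun n => P n - Q n := funext fun n => by rw [h]; lia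
  rw [this]
  exact hP.sub hQ

end IsArithInt

/-- Summation by parts. -/
theorem sub_one_mul_sum_range_pow_mul_pow (q t r : ℕ) :
    ((q : ℤ) - 1) * ∑ j ∈ Finset.range t, (j : ℤ) ^ r * q ^ j
      = t ^ r * q ^ t - 0 ^ r
        - q * ∑ s ∈ Finset.range r,
            (r.choose s : ℤ) * ∑ j ∈ Finset.range t, (j : ℤ) ^ s * q ^ j := by
  induction t with
  | zero => simp
  | succ t ih =>
    simp only [Finset.sum_range_succ, mul_add, Finset.sum_add_distrib]
    have hbin := add_pow (t : ℤ) 1 r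
    rw [Finset.sum_range_succ] at hbin
    simp only [one_pow, mul_one, Nat.choose_self, Nat.cast_one] at hbin
    have hcomm : ∑ s ∈ Finset.range r, (r.choose s : ℤ) * ((t : ℤ) ^ s * q ^ t)
        = q ^ t * ∑ s ∈ Finset.range r, (t : ℤ) ^ s * (r.choose s : ℤ) := by
      rw [Finset.mul_sum]
      exact Finset.sum_congr rfl fun s _ => by ring
    rw [hcomm]
    push_cast
    linear_combination ih - (q : ℤ) ^ (t + 1) * hbin

theorem IsArith.finsetSum {ι : Type*} (S : Finset ι) {F : ι → ℕ → ℕ}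
    (hF : ∀ i ∈ S, IsArith (F i)) : IsArith fun n => ∑ i ∈ S, F i n := by
  classical
  induction S using Finset.induction_on with
  | empty => simpa using IsArith.const 0
  | insert i S hi ih =>
    simp only [Finset.sum_insert hi]
    exact (hF i (by simp)).add (ih fun j hj => hF j (by simp [hj]))

theorem IsArith.sum_range_pow_mul_pow {q t : ℕ → ℕ} (hq : IsArith q) (ht : IsArith t)
    (hq2 : ∀ n, 2 ≤ q n) (r : ℕ) :
    IsArith fun n => ∑ j ∈ Finset.range (t n), j ^ r * q n ^ j := by
  induction r using Nat.strong_induction_on with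
  | _ r ih =>
    have h : (fun n => ∑ j ∈ Finset.range (t n), j ^ r * q n ^ j)
        = fun n => (t n ^ r * q n ^ t n - 0 ^ r - q n * ∑ s ∈ Finset.range r,
            r.choose s * ∑ j ∈ Finset.range (t n), j ^ s * q n ^ j) / (q n - 1) := by
      funext n
      have h2 := hq2 n
      refine (Nat.div_eq_of_eq_mul_right (by lia) ?_).symm
      have h := sub_one_mul_sum_range_pow_mul_pow (q n) (t n) r
      have h' : (q n - 1) * ∑ j ∈ Finset.range (t n), j ^ r * q n ^ j
          + q n * ∑ s ∈ Finset.range r, r.choose s * ∑ j ∈ Finset.range (t n), j ^ s * q n ^ j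
          + 0 ^ r = t n ^ r * q n ^ t n := by
        zify [show 1 ≤ q n by lia]
        linear_combination h
      rw [← h', Nat.add_sub_cancel, Nat.add_sub_cancel]
    rw [h]
    exact ((((ht.pow (const r)).mul (hq.pow ht)).sub (const _)).sub (hq.mul
      (finsetSum _ fun s hs => (const _).mul (ih s (Finset.mem_range.1 hs))))).div
      (hq.sub (const 1)) fun n => by have := hq2 n; lia

/-- Exponential polynomials in `k` unknowns: sums of monomials `c(n) ∏ u_i^(r_i) b_i^(u_i)`, whose
coefficients are differences of arithmetic terms in the parameter `n`. -/
inductive IsExpPoly {k : ℕ} : (ℕ → (Fin k → ℕ) → ℤ) → Prop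
  | monomial {c : ℕ → ℤ} (hc : IsArithInt c) (r b : Fin k → ℕ) (hb : ∀ i, 1 ≤ b i) :
      IsExpPoly fun n u => c n * ∏ i, ((u i : ℤ) ^ r i * (b i : ℤ) ^ u i)
  | add {f g : ℕ → (Fin k → ℕ) → ℤ} (hf : IsExpPoly f) (hg : IsExpPoly g) :
      IsExpPoly fun n u => f n u + g n u

namespace IsExpPoly

variable {k : ℕ} {f g : ℕ → (Fin k → ℕ) → ℤ}

theorem coeff {c : ℕ → ℤ} (hc : IsArithInt c) : IsExpPoly fun n (_ : Fin k → ℕ) => c n := by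
  simpa using monomial (k := k) hc 0 1 fun _ => le_rfl

theorem natCast (c : ℕ) : IsExpPoly fun _ (_ : Fin k → ℕ) => (c : ℤ) :=
  coeff (.natCast (.const c))

theorem coord (i : Fin k) : IsExpPoly fun _ u => (u i : ℤ) := by
  have h := monomial (k := k) (.natCast (.const 1)) (Pi.single i 1) 1 fun _ => le_rfl
  have heq : ∀ u : Fin k → ℕ, ∏ j, (u j : ℤ) ^ (Pi.single i 1 : Fin k → ℕ) j = u i := fun u => by
    rw [Finset.prod_eq_single i] <;> simp +contextual
  simpa [heq] using h

theorem const_pow_coord {b : ℕ} (hb : 1 ≤ b) (i : Fin k) :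
    IsExpPoly fun _ u => (b : ℤ) ^ u i := by
  have h := monomial (k := k) (.natCast (.const 1)) 0 (Pi.mulSingle i b) fun j => by
    rcases eq_or_ne j i with rfl | hj
    · simpa using hb
    · simp [hj]
  have heq : ∀ u : Fin k → ℕ, ∏ j, (((Pi.mulSingle i b : Fin k → ℕ) j : ℕ) : ℤ) ^ u j
      = b ^ u i := fun u => by
    rw [Finset.prod_eq_single i] <;> simp +contextual
  simpa [heq] using h

theorem mul (hf : IsExpPoly f) (hg : IsExpPoly g) : IsExpPoly fun n u => f n u * g n u := by
  induction hf with
  | add _ _ ih ih' =>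
    simp only [add_mul]
    exact ih.add ih'
  | @monomial c hc r b hb =>
    induction hg with
    | add _ _ ih ih' =>
      simp only [mul_add]
      exact ih.add ih'
    | @monomial c' hc' r' b' hb' =>
      have h := monomial (hc.mul hc') (r + r') (b * b') fun i => Nat.mul_le_mul (hb i) (hb' i)
      convert h using 3 with n u
      rw [mul_mul_mul_comm, ← Finset.prod_mul_distrib]
      congr 1
      refine Finset.prod_congr rfl fun i _ => ?_
      simp only [Pi.add_apply, Pi.mul_apply, Nat.cast_mul, mul_pow, pow_add]
      ring

theorem neg (hf : IsExpPoly f) : IsExpPoly fun n u => -f n u := by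
  simpa using (coeff (IsArithInt.natCast (.const 1)).neg).mul hf

theorem sub (hf : IsExpPoly f) (hg : IsExpPoly g) : IsExpPoly fun n u => f n u - g n u := by
  simpa only [sub_eq_add_neg] using hf.add hg.neg

theorem sq (hf : IsExpPoly f) : IsExpPoly fun n u => f n u ^ 2 := by
  simpa only [pow_two] using hf.mul hf

/-- The sum of a monomial over the box, weighted by `2^(2wβ(u))`, is a product of one-dimensional
sums `∑ j < t, j^r q^j`. -/
theorem sum_box (hf : IsExpPoly f) {t w : ℕ → ℕ} (ht : IsArith t) (hw : IsArith w)
    (ht0 : ∀ n, 0 < t n) (hw0 : ∀ n, 0 < w n) :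
    IsArithInt fun n => ∑ a : Fin k → Fin (t n),
      2 ^ (2 * w n * mazzantiBeta a) * f n fun i => (a i : ℕ) := by
  induction hf with
  | add _ _ ih ih' =>
    simp only [mul_add, Finset.sum_add_distrib]
    exact ih.add ih'
  | @monomial c hc r b hb =>
    have h : ∀ n, ∑ a : Fin k → Fin (t n), (2 : ℤ) ^ (2 * w n * mazzantiBeta a)
          * (c n * ∏ i, (((a i : ℕ) : ℤ) ^ r i * (b i : ℤ) ^ (a i : ℕ)))
        = c n * ∏ i, ((∑ j ∈ Finset.range (t n),
            j ^ r i * (2 ^ (2 * w n * t n ^ (i : ℕ)) * b i) ^ j : ℕ) : ℤ) := by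
      intro n
      simp only [← Fin.sum_univ_eq_sum_range
        (fun j => j ^ r _ * (2 ^ (2 * w n * t n ^ (_ : ℕ)) * b _) ^ j)]
      push_cast
      rw [Finset.prod_univ_sum, Fintype.piFinset_univ, Finset.mul_sum]
      refine Finset.sum_congr rfl fun a _ => ?_
      rw [mazzantiBeta, Finset.mul_sum, ← Finset.prod_pow_eq_pow_sum, mul_left_comm,
        ← Finset.prod_mul_distrib]
      congr 1
      refine Finset.prod_congr rfl fun i _ => ?_
      rw [mul_pow, ← pow_mul]
      ring_nf
    simp only [h]
    refine hc.mul (.finsetProd _ fun i => .natCast ?_)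
    refine IsArith.sum_range_pow_mul_pow ?_ ht (fun n => ?_) (r i)
    · exact (((IsArith.const 2).mul hw).mul (ht.pow (.const _))).two_pow.mul (.const _)
    · have h1 : 2 * w n * t n ^ (i : ℕ) ≠ 0 := by
        have := hw0 n
        have := ht0 n
        positivity
      exact Nat.mul_le_mul (Nat.le_self_pow h1 2) (hb i)

theorem mazzantiM (hf : IsExpPoly f) {t w : ℕ → ℕ} (ht : IsArith t) (hw : IsArith w)
    (ht0 : ∀ n, 0 < t n) (hw0 : ∀ n, 0 < w n) :
    IsArithInt fun n => mazzantiM (f n) (t n) (w n) := by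
  have h2 : IsArithInt fun n => (2 : ℤ) ^ w n := by simpa using IsArithInt.natCast hw.two_pow
  have h1 : IsArithInt fun _ => (1 : ℤ) := by simpa using IsArithInt.natCast (.const 1)
  exact ((coeff (h2.add h1.neg)).mul (((coeff h2).sub hf).add (coeff h1))).sum_box ht hw ht0 hw0

end IsExpPoly

theorem isExpPoly_mersenneR : IsExpPoly mersenneR := by
  have two : ∀ i : Fin 19, IsExpPoly fun _ u => (2 : ℤ) ^ u i := fun i =>
    IsExpPoly.const_pow_coord (b := 2) (by norm_num) i
  have eleven : ∀ i : Fin 19, IsExpPoly fun _ u => (11 : ℤ) ^ u i := fun i =>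
    IsExpPoly.const_pow_coord (b := 11) (by norm_num) i
  have var : ∀ i : Fin 19, IsExpPoly fun _ u => (u i : ℤ) := IsExpPoly.coord
  have num : ∀ c : ℕ, IsExpPoly fun _ (_ : Fin 19 → ℕ) => (c : ℤ) := IsExpPoly.natCast
  have par : IsExpPoly fun n (_ : Fin 19 → ℕ) => (2 : ℤ) ^ n :=
    IsExpPoly.coeff (by simpa using IsArithInt.natCast IsArith.id.two_pow)
  have h := (((((((((((((((
    ((var 2).sub (two 0)).sq).add
    ((var 7).sub ((two 0).sq)).sq).add
    ((var 8).sub ((eleven 7).mul (eleven 2).sq)).sq).add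
    ((var 9).sub ((eleven 7).mul (eleven 2))).sq).add
    ((var 10).sub (eleven 2)).sq).add
    ((var 11).sub (eleven 2).sq).sq).add
    ((var 12).sub ((eleven 2).sq.mul (var 3))).sq).add
    ((var 13).sub ((eleven 2).mul (var 3))).sq).add
    ((var 14).sub ((eleven 2).mul (var 6))).sq).add
    ((var 15).sub (((two 0).mul (num 4)).mul (var 18))).sq).add
    (((two 8).mul (two 13).sq.sq).sub
      ((((two 9).sq.mul (two 12)).mul (two 3)).mul (two 4))).sq).add
    ((two 11).sub (((two 10).sq.sq.mul (two 4)).mul (two 5))).sq).add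
    ((two 3).sub ((two 14).mul (two 16))).sq).add
    ((two 10).sub (((two 16).mul (two 17)).mul (num 2))).sq).add
    ((two 15).sub ((two 16).mul (two 18))).sq).add
    (par.sub ((two 0).mul (two 1))).sq
  refine (congrArg IsExpPoly ?_).mpr h
  funext n u
  rw [mersenneR, mersenneSumOfSquares]
  have h4 : ∀ x : ℤ, x ^ 4 = (x ^ 2) ^ 2 := fun x => pow_mul x 2 2
  have h2 : (2 : ℤ) ^ 2 = 4 := by norm_num
  simp only [pow_add, pow_mul', pow_one, Nat.cast_ofNat, h4, h2]

/-! ### Arithmetic terms for the formula and for the count -/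

theorem isArith_mersenneT : IsArith mersenneT :=
  (IsArith.const 11).pow (((IsArith.const 2).mul .id).add (.const 1)).two_pow

theorem isArith_mersenneW : IsArith mersenneW :=
  ((IsArith.const 36).mul isArith_mersenneT).add (.const 6)

theorem isArith_card_mersenneZeros : IsArith fun n => (mersenneZeros n).card := by
  have hT : ∀ n, 0 < mersenneT n := fun n => (Nat.zero_le n).trans_lt (lt_mersenneT n)
  have h : (fun n => (mersenneZeros n).card) = fun n =>
      hammingWeight (mazzantiM (mersenneR n) (mersenneT n) (mersenneW n)).toNat / mersenneW n
        - mersenneT n ^ 19 := funext fun n => by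
    rw [hammingWeight_mersenneM, Nat.mul_div_cancel_left _ (mersenneW_pos n),
      Nat.add_sub_cancel_left]
  rw [h]
  exact (((isExpPoly_mersenneR.mazzantiM isArith_mersenneT isArith_mersenneW hT
    mersenneW_pos).toNat.hammingWeight).div isArith_mersenneW fun n => (mersenneW_pos n).ne').sub
      (isArith_mersenneT.pow (.const 19))

/-- The correction term `1 - ((n - 1) + (1 - n))`, with truncated subtractions, is `1` for `n = 1`
and `0` otherwise. -/
theorem isArith_mersenneCount : IsArith mersenneCount := by
  have h : mersenneCount = fun n => (mersenneZeros n).card + 1 + (1 - ((n - 1) + (1 - n))) := by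
    funext n
    rcases eq_or_ne n 1 with rfl | hn
    · rw [mersenneCount_one, mersenneZeros_one]
      rfl
    · rw [mersenneCount_eq n hn]
      lia
  rw [h]
  exact (isArith_card_mersenneZeros.add (.const 1)).add
    ((IsArith.const 1).sub ((IsArith.id.sub (.const 1)).add ((IsArith.const 1).sub .id)))

theorem mainTheorem1 :
    -- `R` is a single-fold definition of the relation
    -- "`1 ≤ k ≤ n` and `2^(k+2) - 1` is prime" between `n` and its first unknown `k`
    (∀ n k : ℕ, (1 ≤ k ∧ k ≤ n ∧ Nat.Prime (2 ^ (k + 2) - 1)) ↔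
      ∃ u : Fin 19 → ℕ, u 0 = k ∧ mersenneR n u = 0) ∧
    (∀ (n : ℕ) (u u' : Fin 19 → ℕ), u 0 = u' 0 →
      mersenneR n u = 0 → mersenneR n u' = 0 → u = u') ∧
    -- the counting formula
    (∀ n : ℕ, n ≠ 1 → (mersenneCount n : ℚ) = mersenneFormula n) ∧
    -- the formula is an arithmetic term in `n`
    (∃ T : ArithTerm 1, ∀ n : ℕ,
      T.IsDefinedAt ![n] ∧ (T.eval ![n] : ℚ) = mersenneFormula n) ∧
    -- the counting function is an arithmetic term in `n`
    (∃ T : ArithTerm 1, ∀ n : ℕ,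
      T.IsDefinedAt ![n] ∧ T.eval ![n] = mersenneCount n) := by
  refine ⟨mersenneR_solvable_iff, fun n u u' => mersenneR_unique, fun n hn => ?_, ?_,
    isArith_mersenneCount⟩
  · rw [mersenneFormula_eq, mersenneCount_eq n hn]
  · obtain ⟨T, hT⟩ := isArith_card_mersenneZeros.add (.const 1)
    exact ⟨T, fun n => ⟨(hT n).1, by rw [(hT n).2, mersenneFormula_eq]⟩⟩
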